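/- Let $L$ be a group, regarded as a first-order structure in some language in which the group law of $L$ is $\emptyset$-definable (additional structure is allowed). "Definable" means definable with parameters in this structure. For subgroups $H,K\le L$ let $$\widetilde C_K(H)=\{g\in K : [H:C_H(g)]<\infty\},\qquad \widetilde Z(L)=\widetilde C_L(L).$$ (1) Suppose that $L$ is $\aleph_0$-saturated, i.e. every partial $1$-type over a finite set of parameters that is finitely satisfiable in $L$ is realised in $L$. Let $H$ and $K$ be definable subgroups of $L$ such that $K$ normalizes $H$. If $K\le\widetilde C_L(H)$ and $H\le\widetilde C_L(K)$, then the commutator subgroup $[K,H]$ is finite. (2) Suppose that $L$ is an $\widetilde{\mathfrak M}_c$-group, i.e. for any two definable subgroups $H,N$ of $L$ with $N$ normalized by $H$ there are natural numbers $n,d$ such that every chain of centralizers $$C_{H/N}(g_0N)\ge C_{H/N}(g_0N,g_1N)\ge\dots\ge C_{H/N}(g_0N,\dots,g_{m}N)\ge\cdots\qquad(g_i\in H)$$ in $H/N:=H/(H\cap N)$, in which every term after the first has (possibly infinite) index at least $d$ in its predecessor, has length at most $n$. Then the commutator subgroup $[\widetilde Z(L),\widetilde C_L(\widetilde Z(L))]$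 is finite. (No saturation is assumed in this part.) -/

import Mathlib

namespace AlmostCentralizer

open FirstOrder Cardinal

/-- A first-order structure on the group `G` (possibly with extra structure, in an arbitrary
language) is an expansion of the group `G` if the group law is definable without parameters. -/
def ExpandsGroup (Lang : Language) (G : Type*) [Group G] [Lang.Structure G] : Prop :=
  (∅ : Set G).Definable Lang {v : Fin 3 → G | v 0 * v 1 = v 2}

/-- A subgroup is definable if it is first-order definable with parameters. -/
def IsDefinable (Lang : Language) {G : Type*} [Group G] [Lang.Structure G]
    (H : Subgroup G) : Prop :=
  (Set.univ : Set G).Definable₁ Lang (H : Set G)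

/-- `M` is `κ`-saturated: for every parameter set `A` of cardinality less than `κ`, every
partial `1`-type over `A` which is finitely satisfiable in `M` is realised in `M`. A partial type
over `A` is presented as a family of `A`-definable subsets of `M`. -/
def IsSaturated (Lang : Language) {M : Type*} [Lang.Structure M] (κ : Cardinal) : Prop :=
  ∀ A : Set M, #A < κ → ∀ p : Set (Set M), (∀ S ∈ p, A.Definable₁ Lang S) →
    (∀ q ⊆ p, q.Finite → (⋂₀ q).Nonempty) → (⋂₀ p).Nonempty

/-- The almost centralizer of `H` in `K`: the elements `g` of `K` such that
`C_H(g) = C(g) ∩ H` has finite index in `H`. -/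
def almostCentralizer {G : Type*} [Group G] (K H : Subgroup G) : Subgroup G where
  carrier := {g | g ∈ K ∧ (Subgroup.centralizer {g}).IsFiniteRelIndex H}
  one_mem' := by
    refine ⟨K.one_mem, ⟨?_⟩⟩
    have h : Subgroup.centralizer ({1} : Set G) = ⊤ := by
      ext x; simp [Subgroup.mem_centralizer_iff]
    simp [h]
  mul_mem' := by
    rintro a b ⟨ha, ⟨ha'⟩⟩ ⟨hb, ⟨hb'⟩⟩
    refine ⟨K.mul_mem ha hb, ⟨?_⟩⟩
    have h : Subgroup.centralizer {a} ⊓ Subgroup.centralizer {b} ≤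
        Subgroup.centralizer ({a * b} : Set G) := by
      intro x hx
      obtain ⟨hxa, hxb⟩ := Subgroup.mem_inf.1 hx
      simp only [Subgroup.mem_centralizer_iff, Set.mem_singleton_iff, forall_eq] at hxa hxb ⊢
      rw [mul_assoc, hxb, ← mul_assoc, hxa, mul_assoc]
    exact fun h0 => Subgroup.relIndex_inf_ne_zero ha' hb'
      (Subgroup.relIndex_eq_zero_of_le_left h h0)
  inv_mem' := by
    rintro a ⟨ha, ⟨ha'⟩⟩
    refine ⟨K.inv_mem ha, ⟨?_⟩⟩
    have h : Subgroup.centralizer ({a⁻¹} : Set G) = Subgroup.centralizer {a} := by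
      ext x
      simp only [Subgroup.mem_centralizer_iff, Set.mem_singleton_iff, forall_eq]
      exact ⟨fun hx => (Commute.inv_left_iff (a := a) (b := x)).1 hx,
        fun hx => (Commute.inv_left_iff (a := a) (b := x)).2 hx⟩
    rwa [h]

/-- The almost center of a group. -/
def almostCenter (G : Type*) [Group G] : Subgroup G := almostCentralizer ⊤ ⊤

/-- The index of `A` in `B` is at least `d` (an infinite index is at least every `d`; Mathlib's
`relIndex` is `0` when the index is infinite). -/
def IndexAtLeast {G : Type*} [Group G] (d : ℕ) (A B : Subgroup G) : Prop :=
  A.relIndex B = 0 ∨ d ≤ A.relIndex B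

/-- In `Q` there are no chains of more than `n` centralizers
`C(g 0) ≥ C(g 0, g 1) ≥ ... ≥ C(g 0, ..., g (m - 1))` in which each term after the first
has index at least `d` in its predecessor. -/
def CentralizerChainsBounded (Q : Type*) [Group Q] (n d : ℕ) : Prop :=
  ∀ (m : ℕ) (g : ℕ → Q),
    (∀ i, i + 1 < m → IndexAtLeast d (Subgroup.centralizer (g '' Set.Iic (i + 1)))
      (Subgroup.centralizer (g '' Set.Iic i))) → m ≤ n

/-- The chain condition on centralizers up to finite index, for all definable quotients
`H / N = H / (H ∩ N)`, where `H` and `N` are definable subgroups and `H` normalizes `N`. -/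
def IsMcTilde (Lang : Language) (G : Type*) [Group G] [Lang.Structure G] : Prop :=
  ∀ H N : Subgroup G, IsDefinable Lang H → IsDefinable Lang N →
    ∀ hHN : H ≤ Subgroup.normalizer N,
      haveI : (N.subgroupOf H).Normal := Subgroup.normal_subgroupOf_of_le_normalizer hHN
      ∃ n d : ℕ, CentralizerChainsBounded (H ⧸ N.subgroupOf H) n d

end AlmostCentralizer

namespace AlmostCentralizer

open scoped Pointwise commutatorElement

variable {G : Type*} [Group G]

/-! Both parts reduce to one group-theoretic statement, `finite_commutator_of_bounded`: a uniform
bound on the number of `H`-conjugates of elements of `K`, together with finiteness of the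
`K`-conjugacy classes of elements of `H`, makes `⁅K, H⁆` finite when `K` normalizes `H`. A B. H.
Neumann style argument at an element with the most conjugates gives finitely many commutators
(`finite_commutators`). Then `D = ⁅K, H⁆` is finitely generated and central-by-finite, so the
transfer `x ↦ x ^ N`, `N = [D : Z(D)]`, is a homomorphism into `Z(D)`. It is used to show that `D`
is torsion; `Z(D)`, finitely generated, abelian and torsion, is finite, hence so is `D`. The uniform
bound comes from compactness in part (1), and in part (2) from the chain condition applied to `L`
itself. -/

/-- The set of conjugates of `x` by elements of `H`. -/
def conjSet (H : Subgroup G) (x : G) : Set G := {y | ∃ h ∈ H, h * x * h⁻¹ = y}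

theorem conj_mem_conjSet {H : Subgroup G} {h : G} (hh : h ∈ H) (x : G) :
    h * x * h⁻¹ ∈ conjSet H x := ⟨h, hh, rfl⟩

theorem mem_centralizer_singleton {x y : G} :
    y ∈ Subgroup.centralizer {x} ↔ Commute x y := by
  simp only [Subgroup.mem_centralizer_iff, Set.mem_singleton_iff, forall_eq]
  rfl

theorem conj_eq_conj_iff {x a b : G} :
    a * x * a⁻¹ = b * x * b⁻¹ ↔ a⁻¹ * b ∈ Subgroup.centralizer {x} := by
  rw [mem_centralizer_singleton, commute_iff_eq]
  constructor
  · intro h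
    have : x * a⁻¹ = a⁻¹ * (b * x * b⁻¹) := by rw [← h]; group
    rw [← mul_assoc, this]; group
  · intro h
    have : b * x = a * (a⁻¹ * b * x) := by group
    rw [this, ← h]; group

/-- The `H`-conjugates of `x` correspond to the cosets of `C_H(x)` in `H`. -/
noncomputable def quotientEquivConjSet (H : Subgroup G) (x : G) :
    H ⧸ (Subgroup.centralizer {x}).subgroupOf H ≃ conjSet H x :=
  Equiv.ofBijective
    (Quotient.lift (fun h : H => (⟨h * x * (h : G)⁻¹, conj_mem_conjSet h.2 x⟩ : conjSet H x))
      (fun a b hab => Subtype.ext <| conj_eq_conj_iff.2 <| by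
        have := QuotientGroup.leftRel_apply.1 hab
        simpa [Subgroup.mem_subgroupOf] using this))
    ⟨by
      rintro ⟨a⟩ ⟨b⟩ hab
      refine Quotient.sound (QuotientGroup.leftRel_apply.2 ?_)
      have := conj_eq_conj_iff.1 (congrArg Subtype.val hab)
      simpa [Subgroup.mem_subgroupOf] using this, by
      rintro ⟨_, h, hh, rfl⟩
      exact ⟨Quotient.mk _ ⟨h, hh⟩, rfl⟩⟩

theorem ncard_conjSet (H : Subgroup G) (x : G) :
    (conjSet H x).ncard = (Subgroup.centralizer {x}).relIndex H :=
  (Nat.card_congr (quotientEquivConjSet H x)).symm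

theorem finite_conjSet_iff (H : Subgroup G) (x : G) :
    (conjSet H x).Finite ↔ (Subgroup.centralizer {x}).relIndex H ≠ 0 := by
  rw [Subgroup.relIndex, Subgroup.index_ne_zero_iff_finite]
  exact (quotientEquivConjSet H x).finite_iff.symm

/-- A subgroup of finite relative index has finitely many coset representatives. -/
theorem exists_finite_transversal {C K : Subgroup G} (h : C.relIndex K ≠ 0) :
    ∃ T : Set G, T.Finite ∧ T ⊆ K ∧ ∀ k ∈ K, ∃ t ∈ T, t⁻¹ * k ∈ C := by
  have : Finite (K ⧸ C.subgroupOf K) := Subgroup.index_ne_zero_iff_finite.1 h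
  refine ⟨Set.range fun q : K ⧸ C.subgroupOf K => (q.out : G), Set.finite_range _, ?_, ?_⟩
  · rintro _ ⟨q, rfl⟩
    exact q.out.2
  · intro k hk
    refine ⟨_, ⟨((⟨k, hk⟩ : K) : K ⧸ C.subgroupOf K), rfl⟩, ?_⟩
    have := QuotientGroup.eq.1 (QuotientGroup.out_eq' ((⟨k, hk⟩ : K) : K ⧸ C.subgroupOf K))
    simpa [Subgroup.mem_subgroupOf] using this

theorem relIndex_centralizer_ne_zero {K : Subgroup G} {T : Set G} (hT : T.Finite)
    (h : ∀ t ∈ T, (Subgroup.centralizer {t}).relIndex K ≠ 0) :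
    (Subgroup.centralizer T).relIndex K ≠ 0 := by
  have := hT.to_subtype
  have h1 : (⨅ t : T, Subgroup.centralizer {(t : G)}) ≤ Subgroup.centralizer T := by
    intro x hx t ht
    exact (mem_centralizer_singleton.1 (Subgroup.mem_iInf.1 hx ⟨t, ht⟩)).eq
  exact fun h0 => Subgroup.relIndex_iInf_ne_zero (fun t : T => h t t.2)
    (Subgroup.relIndex_eq_zero_of_le_left h1 h0)

/-! ### Finitely many commutators -/

/-- If the elements of `K` have boundedly many conjugates under `H`, and the elements of `H`
have finitely many conjugates under `K`, there are only finitely many commutators. -/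
theorem finite_commutators {H K : Subgroup G} {N : ℕ}
    (hK : ∀ k ∈ K, (conjSet H k).Finite ∧ (conjSet H k).ncard ≤ N)
    (hH : ∀ h ∈ H, (Subgroup.centralizer {h}).relIndex K ≠ 0) :
    {x | ∃ k ∈ K, ∃ h ∈ H, ⁅k, h⁆ = x}.Finite := by
  obtain ⟨k, hk, hmax⟩ : ∃ k ∈ K, ∀ k' ∈ K, (conjSet H k').ncard ≤ (conjSet H k).ncard := by
    have hne : ((fun k => (conjSet H k).ncard) '' (K : Set G)).Nonempty := ⟨_, 1, K.one_mem, rfl⟩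
    have hbd : BddAbove ((fun k => (conjSet H k).ncard) '' (K : Set G)) := by
      refine ⟨N, ?_⟩
      rintro _ ⟨k, hk, rfl⟩
      exact (hK k hk).2
    obtain ⟨k, hk, hke⟩ := Nat.sSup_mem hne hbd
    exact ⟨k, hk, fun k' hk' => (le_csSup hbd ⟨k', hk', rfl⟩).trans hke.ge⟩
  obtain ⟨R, hRfin, hRH, hR⟩ :=
    exists_finite_transversal ((finite_conjSet_iff H k).1 (hK k hk).1)
  have hC : (Subgroup.centralizer R).relIndex K ≠ 0 :=
    relIndex_centralizer_ne_zero hRfin fun r hr => hH r (hRH hr)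
  obtain ⟨T, hTfin, hTK, hT⟩ := exists_finite_transversal hC
  -- Conjugating `k * c` by `R` gives every `y * c` with `y` conjugate to `k`. By maximality of `k`
  -- these are all the conjugates of `k * c`, so `⁅h, c⁆ = (h * k * h⁻¹)⁻¹ * y` for such a `y`.
  have key : ∀ c ∈ K, c ∈ Subgroup.centralizer R → ∀ h ∈ H,
      ⁅h, c⁆ ∈ (conjSet H k)⁻¹ * conjSet H k := by
    intro c hcK hc h hh
    have hsub : (fun y => y * c) '' conjSet H k ⊆ conjSet H (k * c) := by
      rintro _ ⟨_, ⟨g, hg, rfl⟩, rfl⟩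
      obtain ⟨r, hr, hrg⟩ := hR g hg
      refine ⟨r, hRH hr, ?_⟩
      have hrc : r * c = c * r := hc r hr
      have hcr : c * r⁻¹ = r⁻¹ * c := by
        rw [eq_inv_mul_iff_mul_eq, ← mul_assoc, hrc, mul_inv_cancel_right]
      change _ = g * k * g⁻¹ * c
      rw [← conj_eq_conj_iff.2 hrg, mul_assoc, mul_assoc, hcr]
      group
    have heq : (fun y => y * c) '' conjSet H k = conjSet H (k * c) := by
      refine Set.eq_of_subset_of_ncard_le hsub ?_ (hK _ (K.mul_mem hk hcK)).1
      rw [Set.ncard_image_of_injective _ (mul_left_injective c)]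
      exact hmax _ (K.mul_mem hk hcK)
    have hmem := conj_mem_conjSet hh (k * c)
    rw [← heq] at hmem
    obtain ⟨y, hy, hyc⟩ := hmem
    refine ⟨(h * k * h⁻¹)⁻¹, Set.inv_mem_inv.2 (conj_mem_conjSet hh k), y, hy, ?_⟩
    have hy' : y = h * (k * c) * h⁻¹ * c⁻¹ := eq_mul_inv_of_mul_eq hyc
    change _ * y = _
    rw [hy', commutatorElement_def]
    group
  have hfin : (⋃ t ∈ T, conjSet H t * ((conjSet H k)⁻¹ * conjSet H k) * {t⁻¹}).Finite :=
    hTfin.biUnion fun t ht => ((hK t (hTK ht)).1.mul ((hK k hk).1.inv.mul (hK k hk).1)).mul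
      (Set.finite_singleton _)
  refine hfin.inv.subset ?_
  rintro _ ⟨x, hx, h, hh, rfl⟩
  obtain ⟨t, ht, htx⟩ := hT x hx
  rw [Set.mem_inv, commutatorElement_inv]
  -- With `x = t * c`, `⁅h, x⁆ = (h * t * h⁻¹) * ⁅h, c⁆ * t⁻¹`.
  refine Set.mem_biUnion ht ⟨_, ⟨_, conj_mem_conjSet hh t, _,
    key _ (K.mul_mem (K.inv_mem (hTK ht)) hx) htx h hh, rfl⟩, _, rfl, ?_⟩
  simp only [commutatorElement_def]
  group

/-! ### From finitely many commutators to a finite commutator subgroup -/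

theorem isOfFinOrder_commutatorElement {H D : Subgroup G} {k z : G}
    (hk : (Subgroup.centralizer {k}).relIndex H ≠ 0) (hzH : z ∈ H)
    (hkz : ⁅k, z⁆ ∈ D) (hz : z ∈ Subgroup.centralizer (D : Set G)) : IsOfFinOrder ⁅k, z⁆ := by
  obtain ⟨n, hn, -, hnk⟩ := Subgroup.exists_pow_mem_of_relIndex_ne_zero hk hzH
  refine isOfFinOrder_iff_pow_eq_one.2 ⟨n, hn, ?_⟩
  have hc : Commute ⁅k, z⁆ z := hz _ hkz
  -- Since `k` commutes with `z ^ n`, the left side is `z ^ n`, which forces `⁅k, z⁆ ^ n = 1`.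
  have h1 : k * z ^ n * k⁻¹ = ⁅k, z⁆ ^ n * z ^ n := by
    rw [← hc.mul_pow, ← conj_pow, commutatorElement_def]
    group
  have h2 : Commute k (z ^ n) := mem_centralizer_singleton.1 (Subgroup.mem_inf.1 hnk).1
  rw [h2.eq, mul_inv_cancel_right] at h1
  exact right_eq_mul.1 h1

/-- If `H` and `K` almost centralize each other, `K` normalizes `H` and there are only finitely
many commutators, then `⁅K, H⁆` is finite. -/
theorem finite_commutator_of_finite_commutators {H K : Subgroup G}
    (hn : K ≤ Subgroup.normalizer H)
    (hS : {x | ∃ k ∈ K, ∃ h ∈ H, ⁅k, h⁆ = x}.Finite)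
    (hK : ∀ k ∈ K, (Subgroup.centralizer {k}).relIndex H ≠ 0)
    (hH : ∀ h ∈ H, (Subgroup.centralizer {h}).relIndex K ≠ 0) :
    Finite (⁅K, H⁆ : Subgroup G) := by
  have hDH : ⁅K, H⁆ ≤ H := Subgroup.le_normalizer_iff_commutator_le_right.1 hn
  have hDdef := Subgroup.commutator_def K H
  have hFG : Group.FG (⁅K, H⁆ : Subgroup G) := by
    have := hS.to_subtype
    rw [hDdef]
    exact Group.closure_finite_fg _
  have hsH : ∀ s ∈ {x | ∃ k ∈ K, ∃ h ∈ H, ⁅k, h⁆ = x},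
      (Subgroup.centralizer {s}).relIndex H ≠ 0 := by
    rintro _ ⟨k, hk, h, hh, rfl⟩
    rw [← finite_conjSet_iff]
    -- Uses `g * ⁅k, h⁆ * g⁻¹ = ⁅k, g⁆⁻¹ * ⁅k, g * h⁆`.
    refine (hS.inv.mul hS).subset ?_
    rintro _ ⟨g, hg, rfl⟩
    refine ⟨⁅k, g⁆⁻¹, Set.inv_mem_inv.2 ⟨k, hk, g, hg, rfl⟩, ⁅k, g * h⁆,
      ⟨k, hk, _, H.mul_mem hg hh, rfl⟩, ?_⟩
    simp only [commutatorElement_def]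
    group
  have hcent : (Subgroup.centralizer ((⁅K, H⁆ : Subgroup G) : Set G)).relIndex ⁅K, H⁆ ≠ 0 := by
    have h1 := relIndex_centralizer_ne_zero hS hsH
    rw [← Subgroup.centralizer_closure, ← hDdef] at h1
    exact fun h0 => h1 (Subgroup.relIndex_eq_zero_of_le_right hDH h0)
  generalize hD : ⁅K, H⁆ = D at *
  have hcD : (Subgroup.centralizer (D : Set G)).subgroupOf D = Subgroup.center D := by
    ext x
    simp only [Subgroup.mem_subgroupOf, Subgroup.mem_centralizer_iff, Subgroup.mem_center_iff,
      Subtype.forall, Subtype.ext_iff, SetLike.mem_coe, Subgroup.coe_mul]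
  rw [Subgroup.relIndex, hcD] at hcent
  have hfi : (Subgroup.center D).FiniteIndex := ⟨hcent⟩
  set N := (Subgroup.center D).index with hN
  have hpow : ∀ a ∈ D, a ^ N ∈ Subgroup.centralizer (D : Set G) := by
    intro a ha
    have : (⟨a, ha⟩ : D) ^ N ∈ Subgroup.center D := (Subgroup.center D).pow_index_mem _
    rw [← hcD] at this
    simpa [Subgroup.mem_subgroupOf] using this
  have hmul : ∀ a ∈ D, ∀ b ∈ D, (a * b) ^ N = a ^ N * b ^ N := by
    intro a ha b hb
    have := congrArg (fun z : Subgroup.center D => ((z : D) : G))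
      (map_mul (MonoidHom.transferCenterPow D) ⟨a, ha⟩ ⟨b, hb⟩)
    simpa using this
  have hmem : ∀ k ∈ K, ∀ h ∈ H, ⁅k, h⁆ ∈ D := fun k hk h hh =>
    hD ▸ Subgroup.commutator_mem_commutator hk hh
  have hcomm : ∀ k ∈ K, ∀ h ∈ H, IsOfFinOrder ⁅k, h⁆ := by
    intro k hk h hh
    -- Modulo torsion, `k ↦ ⁅k, h⁆ ^ N` respects powers: conjugation by `k` changes the central
    -- element `⁅k ^ m, h⁆ ^ N` only by a commutator of finite order.
    have key : ∀ m : ℕ, ∃ t ∈ D, IsOfFinOrder t ∧ ⁅k ^ m, h⁆ ^ N = t * (⁅k, h⁆ ^ N) ^ m := by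
      intro m
      induction m with
      | zero => exact ⟨1, D.one_mem, IsOfFinOrder.one, by simp⟩
      | succ m ih =>
        obtain ⟨t, htD, ht, hte⟩ := ih
        have hkm : ⁅k ^ m, h⁆ ∈ D := hmem _ (K.pow_mem hk m) _ hh
        have hzD := D.pow_mem hkm N
        have hz := hpow _ hkm
        have hkz := hmem k hk _ (hDH hzD)
        have hcj : k * ⁅k ^ m, h⁆ * k⁻¹ ∈ D := by
          have := D.mul_mem (hmem k hk _ (hDH hkm)) hkm
          rwa [commutatorElement_def k, inv_mul_cancel_right] at this
        refine ⟨⁅k, ⁅k ^ m, h⁆ ^ N⁆ * t, D.mul_mem hkz htD, ?_, ?_⟩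
        · refine Commute.isOfFinOrder_mul ?_
            (isOfFinOrder_commutatorElement (hK k hk) (hDH hzD) hkz hz) ht
          have h1 : ⁅k, ⁅k ^ m, h⁆ ^ N⁆ = (k * ⁅k ^ m, h⁆ * k⁻¹) ^ N * (⁅k ^ m, h⁆ ^ N)⁻¹ := by
            rw [conj_pow, commutatorElement_def]
          rw [h1]
          exact ((Subgroup.mul_mem _ (hpow _ hcj) (Subgroup.inv_mem _ hz)) t htD).symm
        · have h1 : ⁅k ^ (m + 1), h⁆ = (k * ⁅k ^ m, h⁆ * k⁻¹) * ⁅k, h⁆ := by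
            simp only [commutatorElement_def]
            group
          rw [h1, hmul _ hcj _ (hmem k hk h hh), conj_pow, pow_succ, ← mul_assoc,
            mul_assoc _ t, ← hte]
          congr 1
          simp [commutatorElement_def]
    -- For `k ^ n` commuting with `h` the left side of `key` is `1`, so `⁅k, h⁆ ^ (N * n) = t⁻¹` is
    -- torsion.
    obtain ⟨n, hn0, -, hnk⟩ := Subgroup.exists_pow_mem_of_relIndex_ne_zero (hH h hh) hk
    obtain ⟨t, -, ht, hte⟩ := key n
    have h1 : Commute h (k ^ n) := mem_centralizer_singleton.1 (Subgroup.mem_inf.1 hnk).1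
    rw [h1.symm.commutator_eq, one_pow, ← pow_mul] at hte
    have h2 : IsOfFinOrder (⁅k, h⁆ ^ (N * n)) := by
      rw [eq_inv_of_mul_eq_one_right hte.symm]
      exact ht.inv
    exact (isOfFinOrder_pow.1 h2).resolve_right (Nat.mul_pos (Nat.pos_of_ne_zero hcent) hn0).ne'
  have htors : ∀ x ∈ D, IsOfFinOrder x := by
    have hND : N ≠ 0 := hcent
    intro x hx
    rw [hDdef] at hx
    induction hx using Subgroup.closure_induction with
    | mem x hx =>
      obtain ⟨k, hk, h, hh, rfl⟩ := hx
      exact hcomm k hk h hh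
    | one => exact IsOfFinOrder.one
    | mul x y hx hy ihx ihy =>
      rw [← hDdef] at hx hy
      refine ((isOfFinOrder_pow (n := N)).1 ?_).resolve_right hND
      rw [hmul x hx y hy]
      exact Commute.isOfFinOrder_mul (hpow x hx _ (D.pow_mem hy N)).symm ihx.pow ihy.pow
    | inv x hx ih => exact ih.inv
  let _ : CommGroup (Subgroup.center D) :=
    { (inferInstance : Group (Subgroup.center D)) with
      mul_comm := fun a b => Subtype.ext (Subgroup.mem_center_iff.1 b.2 a) }
  -- The center is finitely generated, being of finite index in `D`.
  have hfc : Finite (Subgroup.center D) := CommGroup.finite_of_fg_isMulTorsion _ fun z => by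
    exact Submonoid.isOfFinOrder_coe.1 (Submonoid.isOfFinOrder_coe.1 (htors _ z.1.2))
  have hcard := (Subgroup.center D).card_mul_index
  exact Nat.finite_of_card_ne_zero (hcard ▸ mul_ne_zero Nat.card_pos.ne' hcent)

theorem finite_commutator_of_bounded {H K : Subgroup G} {N : ℕ}
    (hn : K ≤ Subgroup.normalizer H)
    (hK : ∀ k ∈ K, (conjSet H k).Finite ∧ (conjSet H k).ncard ≤ N)
    (hH : ∀ h ∈ H, (Subgroup.centralizer {h}).relIndex K ≠ 0) :
    Finite (⁅K, H⁆ : Subgroup G) :=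
  finite_commutator_of_finite_commutators hn (finite_commutators hK hH)
    (fun k hk => (finite_conjSet_iff H k).1 (hK k hk).1) hH

theorem mem_almostCentralizer_top {H : Subgroup G} {x : G} :
    x ∈ almostCentralizer ⊤ H ↔ (Subgroup.centralizer {x}).relIndex H ≠ 0 :=
  ⟨fun h => h.2.1, fun h => ⟨Subgroup.mem_top x, ⟨h⟩⟩⟩

theorem definable_mem {Lang : FirstOrder.Language} {M : Type*} [Lang.Structure M] {A S : Set M}
    (hS : A.Definable₁ Lang S) {α : Type*} (i : α) :
    A.Definable Lang {v : α → M | v i ∈ S} :=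
  Set.Definable.preimage_comp (fun _ : Fin 1 => i) hS

/-! ### Uniform bounds from saturation -/

section Definability

variable {Lang : FirstOrder.Language} [Lang.Structure G]

theorem ExpandsGroup.definable_mul_eq (hL : ExpandsGroup Lang G) (A : Set G) {α : Type*}
    (i j k : α) : A.Definable Lang {v : α → G | v i * v j = v k} :=
  (hL.mono (Set.empty_subset A)).preimage_comp ![i, j, k]

theorem ExpandsGroup.definable_mem_conjSet (hL : ExpandsGroup Lang G) {A : Set G} {H : Subgroup G}
    (hH : A.Definable₁ Lang (H : Set G)) :
    A.Definable Lang {v : Fin 2 → G | v 1 ∈ conjSet H (v 0)} := by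
  -- `Sum.inr 0` is the conjugator `g`; `Sum.inr 1` is the common value of `g * x` and `y * g`.
  have h := ((definable_mem hH (Sum.inr 0 : Fin 2 ⊕ Fin 2)).inter
    ((hL.definable_mul_eq A (Sum.inr 0 : Fin 2 ⊕ Fin 2) (Sum.inl 0) (Sum.inr 1)).inter
    (hL.definable_mul_eq A (Sum.inl 1 : Fin 2 ⊕ Fin 2) (Sum.inr 0) (Sum.inr 1)))).exists_of_finite
  convert h using 1
  ext v
  constructor
  · rintro ⟨g, hg, hv⟩
    exact ⟨![g, g * v 0], hg, rfl, show v 1 * g = g * v 0 by rw [← hv]; group⟩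
  · rintro ⟨u, hu, h1, h2⟩
    replace h1 : u 0 * v 0 = u 1 := h1
    replace h2 : v 1 * u 0 = u 1 := h2
    exact ⟨u 0, hu, by rw [h1, ← h2]; group⟩

/-- The set of elements of `K` with at least `n` conjugates under `H` is definable. -/
theorem ExpandsGroup.definable_manyConjugates (hL : ExpandsGroup Lang G) {A : Set G}
    {H K : Subgroup G} (hH : A.Definable₁ Lang (H : Set G)) (hK : A.Definable₁ Lang (K : Set G))
    (n : ℕ) :
    A.Definable₁ Lang
      {k | k ∈ K ∧ ∃ f : Fin n → G, Function.Injective f ∧ ∀ i, f i ∈ conjSet H k} := by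
  have hinj : A.Definable Lang
      (⋂ p : {p : Fin n × Fin n // p.1 ≠ p.2},
        {w : Fin 1 ⊕ Fin n → G | w (Sum.inr p.1.1) = w (Sum.inr p.1.2)}ᶜ) :=
    Set.definable_iInter_of_finite fun p => Set.Definable.compl
      ((Set.Definable.diagonal Lang A).preimage_comp ![Sum.inr p.1.1, Sum.inr p.1.2])
  have hconj : A.Definable Lang
      (⋂ i : Fin n, {w : Fin 1 ⊕ Fin n → G | w (Sum.inr i) ∈ conjSet H (w (Sum.inl 0))}) :=
    Set.definable_iInter_of_finite fun i =>
      (hL.definable_mem_conjSet hH).preimage_comp ![Sum.inl 0, Sum.inr i]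
  have h := (definable_mem hK (0 : Fin 1)).inter (hinj.inter hconj).exists_of_finite
  unfold Set.Definable₁
  convert h using 1
  ext v
  refine and_congr Iff.rfl (exists_congr fun f => ?_)
  simp only [Set.mem_inter_iff, Set.mem_iInter, Set.mem_compl_iff]
  refine and_congr ⟨fun hf p hp => p.2 (hf hp), fun hf i j hij => ?_⟩ Iff.rfl
  by_contra hne
  exact hf ⟨(i, j), hne⟩ hij

theorem IsSaturated.exists_ncard_conjSet_le (hs : IsSaturated Lang (M := G) Cardinal.aleph0)
    (hL : ExpandsGroup Lang G) {H K : Subgroup G}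
    (hH : IsDefinable Lang H) (hK : IsDefinable Lang K) (hfin : ∀ k ∈ K, (conjSet H k).Finite) :
    ∃ n, ∀ k ∈ K, (conjSet H k).ncard ≤ n := by
  classical
  obtain ⟨A, -, hA⟩ := Set.definable_iff_finitely_definable.1 hH
  obtain ⟨B, -, hB⟩ := Set.definable_iff_finitely_definable.1 hK
  set S : ℕ → Set G := fun n =>
    {k | k ∈ K ∧ ∃ f : Fin n → G, Function.Injective f ∧ ∀ i, f i ∈ conjSet H k} with hS
  have hanti : Antitone S := by
    rintro m n hmn k ⟨hk, f, hf, hfk⟩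
    exact ⟨hk, f ∘ Fin.castLE hmn, hf.comp (Fin.castLE_injective hmn), fun i => hfk _⟩
  have hmem : ∀ n, ∀ k ∈ K, k ∈ S n ↔ n ≤ (conjSet H k).ncard := by
    intro n k hk
    have := (hfin k hk).to_subtype
    constructor
    · rintro ⟨-, f, hf, hfk⟩
      have := Nat.card_le_card_of_injective (fun i => (⟨f i, hfk i⟩ : conjSet H k))
        fun i j hij => hf (congrArg Subtype.val hij)
      simpa using this
    · intro h
      have e : conjSet H k ≃ Fin (conjSet H k).ncard := Finite.equivFin _
      exact ⟨hk, fun i => e.symm (Fin.castLE h i),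
        Subtype.val_injective.comp (e.symm.injective.comp (Fin.castLE_injective h)),
        fun i => (e.symm _).2⟩
  by_contra! hcon
  have hne : ∀ n, (S n).Nonempty := fun n => by
    obtain ⟨k, hk, hkn⟩ := hcon n
    exact ⟨k, (hmem n k hk).2 hkn.le⟩
  -- Without a bound the decreasing sets `S n` are all nonempty, so some `k` lies in every one and
  -- has infinitely many conjugates.
  obtain ⟨k, hk⟩ := hs (A ∪ B : Set G) (A.finite_toSet.union B.finite_toSet).lt_aleph0
    (Set.range S) (by
      rintro _ ⟨n, rfl⟩
      exact hL.definable_manyConjugates (hA.mono Set.subset_union_left)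
        (hB.mono Set.subset_union_right) n) (by
      intro q hq hqf
      have hq' : ∀ s ∈ q, ∃ n, S n = s := hq
      choose! i hi using hq'
      obtain ⟨b, hb⟩ := (hqf.image i).bddAbove
      obtain ⟨k, hk⟩ := hne b
      refine ⟨k, fun s hs => ?_⟩
      rw [← hi s hs]
      exact hanti (hb ⟨s, hs, rfl⟩) hk)
  have hk' : ∀ n, k ∈ S n := fun n => hk _ ⟨n, rfl⟩
  have hkK := (hk' 0).1
  exact absurd ((hmem _ k hkK).1 (hk' ((conjSet H k).ncard + 1))) (by lia)

theorem isDefinable_top : IsDefinable Lang (⊤ : Subgroup G) := by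
  simp [IsDefinable, Set.Definable₁]

theorem isDefinable_bot : IsDefinable Lang (⊥ : Subgroup G) := by
  rw [IsDefinable, Subgroup.coe_bot]
  exact Set.Definable.singleton_of_mem Lang (Set.mem_univ 1)

end Definability

/-! ### Uniform bounds from the chain condition -/

section Chains

theorem CentralizerChainsBounded.of_mulEquiv {Q : Type*} [Group Q] {n d : ℕ}
    (h : CentralizerChainsBounded Q n d) (e : G ≃* Q) : CentralizerChainsBounded G n d := by
  intro m g hg
  have hcent : ∀ T : Set ℕ, (Subgroup.centralizer ((e ∘ g) '' T)).comap e.toMonoidHom =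
      Subgroup.centralizer (g '' T) := by
    intro T
    ext x
    simp [Subgroup.mem_centralizer_iff, ← map_mul]
  refine h m (e ∘ g) fun i hi => ?_
  have h1 := hg i hi
  have h2 : (Subgroup.centralizer ((e ∘ g) '' Set.Iic (i + 1))).relIndex
      (Subgroup.centralizer ((e ∘ g) '' Set.Iic i)) =
      (Subgroup.centralizer (g '' Set.Iic (i + 1))).relIndex
      (Subgroup.centralizer (g '' Set.Iic i)) := by
    rw [← hcent, ← hcent, Subgroup.relIndex_comap,
      Subgroup.map_comap_eq_self_of_surjective e.surjective]
  rwa [IndexAtLeast, h2]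

theorem IsMcTilde.centralizerChainsBounded {Lang : FirstOrder.Language} [Lang.Structure G]
    (h : IsMcTilde Lang G) : ∃ n d : ℕ, CentralizerChainsBounded G n d := by
  obtain ⟨n, d, hnd⟩ := h ⊤ ⊥ isDefinable_top isDefinable_bot
    (by rw [Subgroup.normalizer_eq_top])
  have hbot : (⊥ : Subgroup G).subgroupOf ⊤ = ⊥ := Subgroup.bot_subgroupOf _
  exact ⟨n, d, hnd.of_mulEquiv (Subgroup.topEquiv.symm.trans
    (QuotientGroup.quotientBot.symm.trans (QuotientGroup.quotientMulEquivOfEq hbot.symm)))⟩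

/-- With bounded centralizer chains, centralizers of elements of `K` have index less than `d` in
the centralizer of a suitable finite subset of `K`. -/
theorem CentralizerChainsBounded.exists_finite {n d : ℕ} (h : CentralizerChainsBounded G n d)
    (K : Subgroup G) :
    ∃ F : Set G, F.Finite ∧ F ⊆ K ∧ ∀ k ∈ K,
      ¬ IndexAtLeast d (Subgroup.centralizer (insert k F)) (Subgroup.centralizer F) := by
  by_contra! hcon
  have key : ∀ m : ℕ, ∃ g : ℕ → G, (∀ i, g i ∈ K) ∧
      ∀ i, i + 1 < m → IndexAtLeast d (Subgroup.centralizer (g '' Set.Iic (i + 1)))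
        (Subgroup.centralizer (g '' Set.Iic i)) := by
    intro m
    induction m with
    | zero => exact ⟨fun _ => 1, fun _ => K.one_mem, by simp⟩
    | succ m ih =>
      obtain ⟨g, hgK, hg⟩ := ih
      -- For `m = 0` the truncated `m - 1` is harmless: a chain of length one carries no index
      -- condition.
      obtain ⟨k, hk, hkd⟩ := hcon (g '' Set.Iic (m - 1)) ((Set.finite_Iic _).image g)
        (by rintro _ ⟨i, -, rfl⟩; exact hgK i)
      have himg : ∀ i < m, Function.update g m k '' Set.Iic i = g '' Set.Iic i := by
        intro i hi
        refine Set.image_congr fun j hj => Function.update_of_ne ?_ _ _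
        exact ((Set.mem_Iic.1 hj).trans_lt hi).ne
      refine ⟨Function.update g m k, fun i => ?_, fun i hi => ?_⟩
      · by_cases him : i = m
        · subst him; simpa using hk
        · simpa [him] using hgK i
      · rcases Nat.lt_or_ge (i + 1) m with him | him
        · rw [himg _ him, himg _ (by lia)]
          exact hg i him
        · obtain rfl : m = i + 1 := by lia
          have hIic : Set.Iic (i + 1) = insert (i + 1) (Set.Iic i) := Order.Iic_succ i
          rw [hIic, Set.image_insert_eq, himg i (by simp)]
          simpa using hkd
  obtain ⟨g, -, hg⟩ := key (n + 1)
  exact absurd (h _ g hg) (by lia)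

theorem CentralizerChainsBounded.exists_ncard_conjSet_le {n d : ℕ}
    (h : CentralizerChainsBounded G n d) (H : Subgroup G) :
    ∃ N, ∀ k ∈ almostCenter G, (conjSet H k).Finite ∧ (conjSet H k).ncard ≤ N := by
  obtain ⟨F, hF, hFK, hd⟩ := h.exists_finite (almostCenter G)
  have hFi : (Subgroup.centralizer F).index ≠ 0 := by
    rw [← Subgroup.relIndex_top_right]
    exact relIndex_centralizer_ne_zero hF fun t ht => mem_almostCentralizer_top.1 (hFK ht)
  -- The centralizer of `k` contains that of `insert k F`, of index below `d` in the finite-index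
  -- centralizer of `F`.
  refine ⟨d * (Subgroup.centralizer F).index, fun k hk => ?_⟩
  obtain ⟨h0, hlt⟩ := not_or.1 (hd k hk)
  have hmul := Subgroup.relIndex_mul_index
    (Subgroup.centralizer_le (Set.subset_insert k F) :
      Subgroup.centralizer (insert k F) ≤ Subgroup.centralizer F)
  have hne : (Subgroup.centralizer (insert k F)).index ≠ 0 := hmul ▸ mul_ne_zero h0 hFi
  have hneH : (Subgroup.centralizer {k}).relIndex H ≠ 0 := fun h1 =>
    mem_almostCentralizer_top.1 hk (Subgroup.relIndex_eq_zero_of_le_right le_top h1)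
  refine ⟨(finite_conjSet_iff H k).2 hneH, ?_⟩
  rw [ncard_conjSet]
  have hsub : Subgroup.centralizer (insert k F) ≤ Subgroup.centralizer {k} :=
    Subgroup.centralizer_le (by simp)
  have hk0 : (Subgroup.centralizer {k}).relIndex ⊤ ≠ 0 := mem_almostCentralizer_top.1 hk
  calc (Subgroup.centralizer {k}).relIndex H
      ≤ (Subgroup.centralizer {k}).relIndex ⊤ := Subgroup.relIndex_le_of_le_right le_top hk0
    _ ≤ (Subgroup.centralizer (insert k F)).relIndex ⊤ :=
        Subgroup.relIndex_le_of_le_left hsub (by rwa [Subgroup.relIndex_top_right])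
    _ ≤ d * (Subgroup.centralizer F).index := by
        rw [Subgroup.relIndex_top_right, ← hmul]
        exact Nat.mul_le_mul_right _ (not_le.1 hlt).le

end Chains

end AlmostCentralizer

theorem mainTheorem10 (Lang : FirstOrder.Language) (L : Type*) [Group L] [Lang.Structure L]
    (hL : AlmostCentralizer.ExpandsGroup Lang L) :
    (AlmostCentralizer.IsSaturated Lang (M := L) Cardinal.aleph0 →
      ∀ H K : Subgroup L,
        AlmostCentralizer.IsDefinable Lang H → AlmostCentralizer.IsDefinable Lang K →
        K ≤ Subgroup.normalizer H →
        K ≤ AlmostCentralizer.almostCentralizer ⊤ H →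
        H ≤ AlmostCentralizer.almostCentralizer ⊤ K →
        Finite (⁅K, H⁆ : Subgroup L)) ∧
    (AlmostCentralizer.IsMcTilde Lang L →
      Finite (⁅AlmostCentralizer.almostCenter L,
        AlmostCentralizer.almostCentralizer ⊤ (AlmostCentralizer.almostCenter L)⁆ :
          Subgroup L)) := by
  open AlmostCentralizer in
  refine ⟨fun hs H K hH hK hn hKH hHK => ?_, fun hM => ?_⟩
  · have hfin : ∀ k ∈ K, (conjSet H k).Finite := fun k hk =>
      (finite_conjSet_iff H k).2 (mem_almostCentralizer_top.1 (hKH hk))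
    obtain ⟨N, hN⟩ := hs.exists_ncard_conjSet_le hL hH hK hfin
    exact finite_commutator_of_bounded hn (fun k hk => ⟨hfin k hk, hN k hk⟩)
      fun h hh => mem_almostCentralizer_top.1 (hHK hh)
  · obtain ⟨n, d, hnd⟩ := hM.centralizerChainsBounded
    obtain ⟨N, hN⟩ := hnd.exists_ncard_conjSet_le (almostCentralizer ⊤ (almostCenter L))
    have hle : almostCenter L ≤ almostCentralizer ⊤ (almostCenter L) := fun k hk =>
      mem_almostCentralizer_top.2 fun h0 => mem_almostCentralizer_top.1 hk
        (Subgroup.relIndex_eq_zero_of_le_right le_top h0)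
    exact finite_commutator_of_bounded (hle.trans Subgroup.le_normalizer) hN
      fun h hh => mem_almostCentralizer_top.1 hh
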